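/- Let $N\ge 1$ and, for $m\in\{1,\dots,N\}$, let $\alpha_m,\beta_m,\rho_m,\bar h_m>0$ be real numbers with $\alpha_m-\beta_m\notin\mathbb Z$. Let $\tilde h_1,\dots,\tilde h_N$ be independent (not necessarily identically distributed) random variables, $\tilde h_m$ having the Gamma-Gamma distribution with parameters $\alpha_m,\beta_m$, i.e. the probability density $$f_m(x)=\frac{2(\alpha_m\beta_m)^{\frac{\alpha_m+\beta_m}{2}}}{\Gamma(\alpha_m)\Gamma(\beta_m)}\,x^{\frac{\alpha_m+\beta_m}{2}-1}K_{\alpha_m-\beta_m}\!\left(2\sqrt{\alpha_m\beta_m x}\right)\quad(x>0),\qquad f_m(x)=0\quad(x\le 0),$$ where $K_\nu$ is the modified Bessel function of the second kind of order $\nu$. Put $h_m=\bar h_m\tilde h_m$, $p_m=\max(\alpha_m,\beta_m)$ and $q_m=\min(\alpha_m,\beta_m)$. Let $S\subseteq\{1,\dots,N\}$ be non-empty and let $F_S$ be the cumulative distribution function of the weighted sum $h_S=\sum_{m\in S}\rho_m h_m$. Then, as $x\to 0^+$, $$F_S(x)\;\sim\;\frac{\prod_{m\in S} c_m\,\Gamma(q_m)}{\left(\sum_{m\in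 S}q_m\right)\Gamma\!\left(\sum_{m\in S}q_m\right)}\;x^{\sum_{m\in S}q_m},\qquad c_m=\left(\frac{\alpha_m\beta_m}{\bar h_m\rho_m}\right)^{q_m}\frac{\Gamma(p_m-q_m)}{\Gamma(\alpha_m)\Gamma(\beta_m)},$$ that is, the ratio of the two sides tends to $1$. -/

import Mathlib

open MeasureTheory ProbabilityTheory Filter Topology

noncomputable section

/-- The modified Bessel function of the second kind `K_ν(z)`, for real order `ν` and `z > 0`, by
the integral representation
`K_ν(z) = (1/2) (z/2)^ν ∫_0^∞ exp(-t - z²/(4t)) t^(-ν-1) dt`,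
which converges for every real `ν` and every `z > 0`. -/
def besselK (ν z : ℝ) : ℝ :=
  (1 / 2) * (z / 2) ^ ν *
    ∫ t in Set.Ioi (0 : ℝ), Real.exp (-t - z ^ 2 / (4 * t)) * t ^ (-ν - 1)

/-- The probability density function of the (unit-mean) Gamma-Gamma distribution with parameters
`α, β > 0`; it vanishes outside the positive half-line. -/
def gammaGammaPDF (α β x : ℝ) : ℝ :=
  if 0 < x then
    2 * (α * β) ^ ((α + β) / 2) / (Real.Gamma α * Real.Gamma β) * x ^ ((α + β) / 2 - 1) *
      besselK (α - β) (2 * Real.sqrt (α * β * x))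
  else 0

/-- The Gamma-Gamma distribution with parameters `α, β > 0`, as a measure on the real line. -/
def gammaGammaMeasure (α β : ℝ) : Measure ℝ :=
  volume.withDensity fun x => ENNReal.ofReal (gammaGammaPDF α β x)

end

/-! Near `0` only the leading power of each density matters. Since `K_ν(z) ~ Γ(ν)/2 * (z/2)^(-ν)`
for `ν > 0` and `K` is even in `ν`, each Gamma-Gamma density is equivalent to a constant times
`x^(q-1)` (`gammaGammaPDF_isEquivalent`).

Summands are then added one at a time (`isEquivalent_prod_withDensity_add_mul_le`). The distribution
function of `X + aY` integrates that of `X` at `x - a v` against the density of `Y`. Both arguments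
are small when `x` is, so the equivalents can be inserted; a Beta integral remains. Exponents add,
and the Gamma factors telescope. -/

/-! ### Small-argument behaviour of the Bessel function. -/

/-- The substitution `t ↦ z²/(4t)`, an inversion followed by a scaling, exchanges the two terms of
the exponent. -/
theorem integral_exp_neg_sub_div_mul_rpow_neg {ν z : ℝ} (hz : 0 < z) :
    ∫ t in Set.Ioi (0 : ℝ), Real.exp (-t - z ^ 2 / (4 * t)) * t ^ (-ν - 1) =
      (z / 2) ^ (-2 * ν) *
        ∫ t in Set.Ioi (0 : ℝ), Real.exp (-t - z ^ 2 / (4 * t)) * t ^ (ν - 1) := by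
  set c : ℝ := z ^ 2 / 4 with hc
  have hc0 : 0 < c := by positivity
  have h1 := integral_comp_rpow_Ioi
    (fun t : ℝ => Real.exp (-(c * t) - z ^ 2 / (4 * (c * t))) * (c * t) ^ (-ν - 1))
    (p := -1) (by norm_num)
  have h2 := integral_comp_mul_left_Ioi
    (fun t : ℝ => Real.exp (-t - z ^ 2 / (4 * t)) * t ^ (-ν - 1)) 0 hc0
  rw [mul_zero, smul_eq_mul] at h2
  rw [h2] at h1
  have h3 : ∫ t in Set.Ioi (0 : ℝ), Real.exp (-t - z ^ 2 / (4 * t)) * t ^ (-ν - 1) =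
      c * (c⁻¹ * ∫ t in Set.Ioi (0 : ℝ), Real.exp (-t - z ^ 2 / (4 * t)) * t ^ (-ν - 1)) :=
    (mul_inv_cancel_left₀ hc0.ne' _).symm
  rw [h3, ← h1, ← integral_const_mul, ← integral_const_mul]
  refine setIntegral_congr_fun measurableSet_Ioi fun t ht => ?_
  have ht0 : 0 < t := ht
  have hz4 : z ^ 2 = 4 * c := by rw [hc]; ring
  have hpow : (z / 2) ^ (-2 * ν) = c ^ (-ν) := by
    rw [show c = (z / 2) ^ (2 : ℝ) by rw [Real.rpow_two, hc]; ring, ← Real.rpow_mul (by positivity)]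
    ring_nf
  have he : -(c * t⁻¹) - 4 * c / (4 * (c * t⁻¹)) = -t - 4 * c / (4 * t) := by
    field_simp
    ring
  have hp : c * (t ^ (-2 : ℝ) * (c * t⁻¹) ^ (-ν - 1)) = c ^ (-ν) * t ^ (ν - 1) := by
    rw [Real.mul_rpow hc0.le (by positivity), Real.inv_rpow ht0.le, ← Real.rpow_neg ht0.le,
      show ν - 1 = -2 + -(-ν - 1) by ring, Real.rpow_add ht0, Real.rpow_sub_one hc0.ne']
    field_simp
  have habs : |(-1 : ℝ)| * t ^ (-1 - 1 : ℝ) = t ^ (-2 : ℝ) := by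
    rw [abs_neg, abs_one, one_mul]
    norm_num
  simp only [smul_eq_mul, Real.rpow_neg_one, hpow, hz4, he, habs]
  rw [show c * (t ^ (-2 : ℝ) * (Real.exp (-t - 4 * c / (4 * t)) * (c * t⁻¹) ^ (-ν - 1))) =
    (c * (t ^ (-2 : ℝ) * (c * t⁻¹) ^ (-ν - 1))) * Real.exp (-t - 4 * c / (4 * t)) by ring, hp]
  ring

/-- For `ν > 0` this integral stays finite as `z → 0`, whereas the defining one diverges. -/
theorem besselK_eq_rpow_neg_mul (ν : ℝ) {z : ℝ} (hz : 0 < z) :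
    besselK ν z = (1 / 2) * (z / 2) ^ (-ν) *
      ∫ t in Set.Ioi (0 : ℝ), Real.exp (-t - z ^ 2 / (4 * t)) * t ^ (ν - 1) := by
  rw [besselK, integral_exp_neg_sub_div_mul_rpow_neg hz, show -ν = ν + -2 * ν by ring,
    Real.rpow_add (by positivity : 0 < z / 2)]
  ring

theorem besselK_neg (ν : ℝ) {z : ℝ} (hz : 0 < z) : besselK (-ν) z = besselK ν z := by
  rw [besselK_eq_rpow_neg_mul ν hz, besselK, neg_neg]

theorem tendsto_integral_exp_neg_sub_div_mul_rpow {ν : ℝ} (hν : 0 < ν) :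
    Tendsto (fun z : ℝ => ∫ t in Set.Ioi (0 : ℝ), Real.exp (-t - z ^ 2 / (4 * t)) * t ^ (ν - 1))
      (𝓝 0) (𝓝 (Real.Gamma ν)) := by
  rw [Real.Gamma_eq_integral hν]
  refine tendsto_integral_filter_of_dominated_convergence
    (fun t => Real.exp (-t) * t ^ (ν - 1)) ?_ ?_ (Real.GammaIntegral_convergent hν) ?_
  · exact Eventually.of_forall fun z => by fun_prop
  · refine Eventually.of_forall fun z => ?_
    filter_upwards [ae_restrict_mem measurableSet_Ioi] with t ht
    have ht0 : 0 < t := ht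
    have : 0 ≤ z ^ 2 / (4 * t) := by positivity
    rw [Real.norm_of_nonneg (by positivity)]
    gcongr
    linarith
  · refine Eventually.of_forall fun t => ?_
    have : Continuous fun z : ℝ => Real.exp (-t - z ^ 2 / (4 * t)) * t ^ (ν - 1) := by fun_prop
    simpa using this.tendsto 0

theorem measurable_besselK (ν : ℝ) : Measurable (besselK ν) := by
  have h : StronglyMeasurable fun z : ℝ => ∫ t in Set.Ioi (0 : ℝ),
      Real.exp (-t - z ^ 2 / (4 * t)) * t ^ (-ν - 1) :=
    StronglyMeasurable.integral_prod_right' (f := fun p : ℝ × ℝ =>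
      Real.exp (-p.2 - p.1 ^ 2 / (4 * p.2)) * p.2 ^ (-ν - 1))
      (Measurable.stronglyMeasurable (by fun_prop))
  unfold besselK
  exact Measurable.mul (by fun_prop) h.measurable

/-! ### The Gamma-Gamma density near zero. -/

theorem measurable_gammaGammaPDF (α β : ℝ) : Measurable (gammaGammaPDF α β) := by
  have := measurable_besselK (α - β)
  refine Measurable.ite measurableSet_Ioi ?_ measurable_const
  fun_prop

theorem gammaGammaPDF_of_nonpos (α β : ℝ) {x : ℝ} (hx : x ≤ 0) : gammaGammaPDF α β x = 0 :=
  if_neg hx.not_gt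

theorem gammaGammaPDF_comm {α β : ℝ} (hα : 0 < α) (hβ : 0 < β) (x : ℝ) :
    gammaGammaPDF α β x = gammaGammaPDF β α x := by
  unfold gammaGammaPDF
  split_ifs with hx
  · rw [← besselK_neg (α - β) (by positivity), neg_sub, mul_comm α β, add_comm α β,
      mul_comm (Real.Gamma α)]
  · rfl

theorem gammaGammaPDF_isEquivalent_of_lt {α β : ℝ} (hβ : 0 < β) (h : β < α) :
    Asymptotics.IsEquivalent (𝓝[>] (0 : ℝ)) (gammaGammaPDF α β) (fun x =>
      (α * β) ^ β * Real.Gamma (α - β) / (Real.Gamma α * Real.Gamma β) * x ^ (β - 1)) := by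
  have hα : 0 < α := hβ.trans h
  have hΓα := Real.Gamma_pos_of_pos hα
  have hΓβ := Real.Gamma_pos_of_pos hβ
  have hsub : Tendsto (fun x : ℝ => 2 * Real.sqrt (α * β * x)) (𝓝[>] 0) (𝓝 0) := by
    have : Continuous fun x : ℝ => 2 * Real.sqrt (α * β * x) := by fun_prop
    simpa using (this.tendsto 0).mono_left nhdsWithin_le_nhds
  have hJ := (tendsto_integral_exp_neg_sub_div_mul_rpow (sub_pos.2 h)).comp hsub
  have hE := (Asymptotics.isEquivalent_const_iff_tendsto
    (Real.Gamma_pos_of_pos (sub_pos.2 h)).ne').2 hJ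
  have hR : Asymptotics.IsEquivalent (𝓝[>] (0 : ℝ))
      (fun x : ℝ => (α * β) ^ β / (Real.Gamma α * Real.Gamma β) * x ^ (β - 1))
      (fun x : ℝ => (α * β) ^ β / (Real.Gamma α * Real.Gamma β) * x ^ (β - 1)) :=
    Asymptotics.IsEquivalent.refl
  refine ((hR.mul hE).congr_left ?_).congr_right ?_
  · filter_upwards [self_mem_nhdsWithin] with x hx
    have hx0 : 0 < x := hx
    have hab : 0 < α * β := mul_pos hα hβ
    have hs : 0 < 2 * Real.sqrt (α * β * x) := by positivity
    rw [gammaGammaPDF, if_pos hx0, besselK_eq_rpow_neg_mul _ hs, Pi.mul_apply, Function.comp_apply]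
    generalize (∫ t in Set.Ioi (0 : ℝ), Real.exp (-t - (2 * Real.sqrt (α * β * x)) ^ 2 / (4 * t)) *
      t ^ (α - β - 1)) = J
    rw [mul_div_cancel_left₀ _ two_ne_zero, Real.sqrt_eq_rpow, ← Real.rpow_mul (by positivity),
      Real.mul_rpow hab.le hx0.le]
    have e1 : (α * β) ^ β = (α * β) ^ ((α + β) / 2) * (α * β) ^ (1 / 2 * -(α - β)) := by
      rw [← Real.rpow_add hab]; ring_nf
    have e2 : x ^ (β - 1) = x ^ ((α + β) / 2 - 1) * x ^ (1 / 2 * -(α - β)) := by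
      rw [← Real.rpow_add hx0]; ring_nf
    rw [e1, e2]
    ring
  · refine Eventually.of_forall fun x => ?_
    simp only [Pi.mul_apply, Function.const_apply]
    ring

theorem gammaGammaPDF_isEquivalent {α β : ℝ} (hα : 0 < α) (hβ : 0 < β) (h : α ≠ β) :
    Asymptotics.IsEquivalent (𝓝[>] (0 : ℝ)) (gammaGammaPDF α β) (fun x =>
      (α * β) ^ min α β * Real.Gamma (max α β - min α β) / (Real.Gamma α * Real.Gamma β) *
        x ^ (min α β - 1)) := by
  rcases h.lt_or_gt with h | h
  · rw [min_eq_left h.le, max_eq_right h.le, mul_comm α β, mul_comm (Real.Gamma α),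
      funext (gammaGammaPDF_comm hα hβ)]
    exact gammaGammaPDF_isEquivalent_of_lt hα h
  · rw [min_eq_right h.le, max_eq_left h.le]
    exact gammaGammaPDF_isEquivalent_of_lt hβ h

/-! ### Adding an independent variable with a power-like density. -/

/-- Two-sided bounds by a factor `k` pass through products and integrals. -/
theorem Asymptotics.isEquivalent_iff_forall_one_lt {ι : Type*} {l : Filter ι} {f g : ι → ℝ}
    (hg : ∀ᶠ x in l, 0 ≤ g x) :
    Asymptotics.IsEquivalent l f g ↔
      ∀ k : ℝ, 1 < k → ∀ᶠ x in l, f x ≤ k * g x ∧ g x ≤ k * f x := by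
  rw [Asymptotics.IsEquivalent, Asymptotics.isLittleO_iff]
  constructor
  · intro h k hk
    have hk0 : 0 < k := one_pos.trans hk
    filter_upwards [hg, h (div_pos (sub_pos.2 hk) hk0)] with x h0 hx
    rw [Pi.sub_apply, Real.norm_eq_abs, Real.norm_of_nonneg h0, abs_le, div_mul_eq_mul_div] at hx
    obtain ⟨h1, h2⟩ := hx
    rw [le_div_iff₀ hk0] at h2
    rw [neg_le, le_div_iff₀ hk0] at h1
    constructor
    · have : (f x - g x) * 1 ≤ (k - 1) * g x := by
        rcases le_total 0 (f x - g x) with h | h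
        · exact (mul_le_mul_of_nonneg_left hk.le h).trans h2
        · exact (mul_nonpos_of_nonpos_of_nonneg h zero_le_one).trans
            (mul_nonneg (sub_pos.2 hk).le h0)
      linarith
    · linarith
  · intro h c hc
    filter_upwards [hg, h (1 + c) (by linarith)] with x h0 ⟨h1, h2⟩
    rw [Pi.sub_apply, Real.norm_eq_abs, Real.norm_of_nonneg h0, abs_le]
    refine ⟨?_, by linarith⟩
    -- Otherwise `g ≤ (1 + c) f < (1 - c²) g`.
    by_contra! hlt
    nlinarith [mul_nonneg (mul_nonneg hc.le hc.le) h0]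

theorem lintegral_rpow_sub_mul_rpow {a x A b : ℝ} (ha : 0 < a) (hx : 0 < x) (hA : 0 < A + 1)
    (hb : 0 < b) :
    ∫⁻ v in Set.Ioo 0 (x / a), ENNReal.ofReal ((x - a * v) ^ A * v ^ (b - 1)) =
      ENNReal.ofReal (a ^ (-b) * x ^ (A + b) * beta b (A + 1)) := by
  have hxa : 0 < x / a := div_pos hx ha
  have hB : 0 < beta b (A + 1) := beta_pos hb hA
  have himg : (fun t : ℝ => x / a * t) '' Set.Ioo 0 1 = Set.Ioo 0 (x / a) := by
    rw [Set.image_mul_left_Ioo hxa, mul_zero, mul_one]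
  rw [← himg, lintegral_image_eq_lintegral_abs_deriv_mul measurableSet_Ioo
    (f' := fun _ => x / a)
    (fun t _ => by simpa using ((hasDerivAt_id t).const_mul (x / a)).hasDerivWithinAt)
    ((mul_right_injective₀ hxa.ne').injOn)]
  -- The Beta integral is read off from the total mass of the Beta density.
  have h1 := lintegral_betaPDF_eq_one hb hA
  rw [lintegral_betaPDF] at h1
  rw [← mul_one (ENNReal.ofReal (a ^ (-b) * x ^ (A + b) * beta b (A + 1))), ← h1,
    ← lintegral_const_mul' _ _ ENNReal.ofReal_ne_top]
  refine setLIntegral_congr_fun measurableSet_Ioo fun t ht => ?_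
  have ht0 : 0 < t := ht.1
  have ht1 : 0 < 1 - t := sub_pos.2 ht.2
  rw [← ENNReal.ofReal_mul (abs_nonneg _), ← ENNReal.ofReal_mul (by positivity), abs_of_pos hxa,
    show x - a * (x / a * t) = x * (1 - t) by field_simp, Real.mul_rpow hx.le ht1.le,
    Real.mul_rpow hxa.le ht0.le, Real.div_rpow hx.le ha.le, Real.rpow_neg ha.le,
    Real.rpow_add hx, Real.rpow_sub_one hx.ne', Real.rpow_sub_one ha.ne', add_sub_cancel_right]
  congr 1
  field_simp

theorem prod_withDensity_add_mul_le (μ : Measure ℝ) [IsProbabilityMeasure μ]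
    (hμ : μ (Set.Iio 0) = 0) {g : ℝ → ℝ} (hg : Measurable g) (hg0 : ∀ v ≤ 0, g v = 0)
    {a : ℝ} (ha : 0 < a) (x : ℝ) :
    (μ.prod (volume.withDensity fun v => ENNReal.ofReal (g v))) {p | p.1 + a * p.2 ≤ x} =
      ∫⁻ v in Set.Ioo 0 (x / a), μ (Set.Iic (x - a * v)) * ENNReal.ofReal (g v) := by
  have hF : Measurable fun v : ℝ => μ (Set.Iic (x - a * v)) := by
    have : Antitone fun v : ℝ => μ (Set.Iic (x - a * v)) := fun u v huv =>
      measure_mono (Set.Iic_subset_Iic.2 (by gcongr))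
    exact this.measurable
  rw [Measure.prod_apply_symm (measurableSet_le (by fun_prop) (by fun_prop))]
  have hset : ∀ v : ℝ, (fun u : ℝ => (u, v)) ⁻¹' {p : ℝ × ℝ | p.1 + a * p.2 ≤ x} =
      Set.Iic (x - a * v) := fun v => by ext u; simp [le_sub_iff_add_le]
  simp_rw [hset]
  rw [lintegral_withDensity_eq_lintegral_mul _ hg.ennreal_ofReal hF,
    ← lintegral_indicator measurableSet_Ioo]
  refine lintegral_congr_ae ?_
  -- The endpoint must be discarded: `μ` may have an atom at `0`.
  have hne : ∀ᵐ v : ℝ, v ≠ x / a := by simp [ae_iff]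
  filter_upwards [hne] with v hv
  rw [Pi.mul_apply, mul_comm]
  by_cases hm : v ∈ Set.Ioo 0 (x / a)
  · rw [Set.indicator_of_mem hm]
  · rw [Set.indicator_of_notMem hm]
    rcases le_or_gt v 0 with h0 | h0
    · simp [hg0 v h0]
    · have hlt : x / a < v := lt_of_le_of_ne (not_lt.1 fun h => hm ⟨h0, h⟩) hv.symm
      rw [div_lt_iff₀ ha] at hlt
      rw [measure_mono_null (Set.Iic_subset_Iio.2 (by linarith)) hμ, zero_mul]

/-- Normalising by `Γ(A + 1)` cancels that factor of the Beta function, so each step multiplies `C`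
by `a^(-b) B Γ(b)`. The case `A = 0` admits the empty sum. -/
theorem isEquivalent_prod_withDensity_add_mul_le (μ : Measure ℝ) [IsProbabilityMeasure μ]
    (hμ : μ (Set.Iio 0) = 0) {g : ℝ → ℝ} (hg : Measurable g) (hg0 : ∀ v ≤ 0, g v = 0)
    [IsFiniteMeasure (volume.withDensity fun v => ENNReal.ofReal (g v))]
    {a A b B C : ℝ} (ha : 0 < a) (hA : 0 ≤ A) (hb : 0 < b) (hB : 0 < B) (hC : 0 < C)
    (hμE : Asymptotics.IsEquivalent (𝓝[>] (0 : ℝ)) (fun x => μ.real (Set.Iic x))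
      (fun x => C / Real.Gamma (A + 1) * x ^ A))
    (hgE : Asymptotics.IsEquivalent (𝓝[>] (0 : ℝ)) g (fun x => B * x ^ (b - 1))) :
    Asymptotics.IsEquivalent (𝓝[>] (0 : ℝ))
      (fun x => (μ.prod (volume.withDensity fun v => ENNReal.ofReal (g v))).real
        {p | p.1 + a * p.2 ≤ x})
      (fun x => C * (a ^ (-b) * B * Real.Gamma b) / Real.Gamma (A + b + 1) * x ^ (A + b)) := by
  have hA1 : 0 < A + 1 := by linarith
  have hΓA := Real.Gamma_pos_of_pos hA1
  have hΓb := Real.Gamma_pos_of_pos hb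
  have hΓAb := Real.Gamma_pos_of_pos (by linarith : 0 < A + b + 1)
  have hmem : ∀ᶠ x in 𝓝[>] (0 : ℝ), 0 < x := self_mem_nhdsWithin
  rw [Asymptotics.isEquivalent_iff_forall_one_lt
    (by filter_upwards [hmem] with x hx; positivity)] at hμE hgE ⊢
  intro k hk
  have hk0 : 0 < k := one_pos.trans hk
  -- Each of the two factors of the integrand may lose `√k`.
  have hs1 : 1 < Real.sqrt k := Real.lt_sqrt_of_sq_lt (by simpa using hk)
  obtain ⟨δ, hδ, hδμ⟩ := mem_nhdsGT_iff_exists_Ioo_subset.1 ((hμE _ hs1).and (hgE _ hs1))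
  have hδ0 : 0 < δ := hδ
  have hsq : Real.sqrt k * Real.sqrt k = k := Real.mul_self_sqrt hk0.le
  set s := Real.sqrt k
  have hs0 : 0 < s := one_pos.trans hs1
  filter_upwards [Ioo_mem_nhdsGT (lt_min hδ0 (mul_pos ha hδ0))] with x hx
  have hx0 : 0 < x := hx.1
  have hxδ : x < δ := hx.2.trans_le (min_le_left _ _)
  have hxaδ : x / a < δ := by
    rw [div_lt_iff₀' ha]; exact hx.2.trans_le (min_le_right _ _)
  set L : ℝ → ℝ := fun v => C / Real.Gamma (A + 1) * (x - a * v) ^ A * (B * v ^ (b - 1)) with hL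
  have hLint : ∫⁻ v in Set.Ioo 0 (x / a), ENNReal.ofReal (L v) = ENNReal.ofReal
      (C * (a ^ (-b) * B * Real.Gamma b) / Real.Gamma (A + b + 1) * x ^ (A + b)) := by
    have : ∀ v, ENNReal.ofReal (L v) = ENNReal.ofReal (C / Real.Gamma (A + 1) * B) *
        ENNReal.ofReal ((x - a * v) ^ A * v ^ (b - 1)) := fun v => by
      rw [← ENNReal.ofReal_mul (by positivity), hL]; congr 1; ring
    simp_rw [this]
    rw [lintegral_const_mul' _ _ ENNReal.ofReal_ne_top, lintegral_rpow_sub_mul_rpow ha hx0 hA1 hb,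
      ← ENNReal.ofReal_mul (by positivity), beta, show b + (A + 1) = A + b + 1 by ring]
    congr 1
    field_simp
  have hH := prod_withDensity_add_mul_le μ hμ hg hg0 ha x
  have hpt : ∀ v ∈ Set.Ioo 0 (x / a),
      μ.real (Set.Iic (x - a * v)) * g v ≤ k * L v ∧
      L v ≤ k * (μ.real (Set.Iic (x - a * v)) * g v) ∧ 0 ≤ g v := by
    intro v hv
    have hv0 : 0 < v := hv.1
    have hv1 : v * a < x := (lt_div_iff₀ ha).1 hv.2
    have hu0 : 0 < x - a * v := by linarith
    have hu : x - a * v ∈ Set.Ioo 0 δ := ⟨hu0, by nlinarith⟩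
    obtain ⟨m1, m2⟩ := (hδμ hu).1
    obtain ⟨g1, g2⟩ := (hδμ (⟨hv0, hv.2.trans hxaδ⟩ : v ∈ Set.Ioo 0 δ)).2
    have l1 : 0 ≤ C / Real.Gamma (A + 1) * (x - a * v) ^ A := by positivity
    have l2 : 0 ≤ B * v ^ (b - 1) := by positivity
    -- Near `0`, nonnegativity of `g` follows from its lower bound.
    have hgv : 0 ≤ g v := nonneg_of_mul_nonneg_right (l2.trans g2) hs0
    refine ⟨?_, ?_, hgv⟩
    · calc _ ≤ (s * (C / Real.Gamma (A + 1) * (x - a * v) ^ A)) * (s * (B * v ^ (b - 1))) := by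
            gcongr
        _ = s * s * L v := by rw [hL]; ring
        _ = k * L v := by rw [hsq]
    · calc L v ≤ (s * μ.real (Set.Iic (x - a * v))) * (s * g v) :=
            mul_le_mul m2 g2 l2 (mul_nonneg hs0.le measureReal_nonneg)
        _ = s * s * (μ.real (Set.Iic (x - a * v)) * g v) := by ring
        _ = _ := by rw [hsq]
  have hofReal : ∀ v, μ (Set.Iic (x - a * v)) * ENNReal.ofReal (g v) =
      ENNReal.ofReal (μ.real (Set.Iic (x - a * v)) * g v) := fun v => by
    rw [ENNReal.ofReal_mul measureReal_nonneg, ofReal_measureReal]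
  simp_rw [hofReal] at hH
  set R := C * (a ^ (-b) * B * Real.Gamma b) / Real.Gamma (A + b + 1) * x ^ (A + b)
  have hR0 : 0 ≤ R := by positivity
  set M := μ.prod (volume.withDensity fun v => ENNReal.ofReal (g v))
  constructor
  · refine ENNReal.toReal_le_of_le_ofReal (by positivity) ?_
    rw [hH, ENNReal.ofReal_mul hk0.le, ← hLint, ← lintegral_const_mul' _ _ ENNReal.ofReal_ne_top]
    refine setLIntegral_mono' measurableSet_Ioo fun v hv => ?_
    rw [← ENNReal.ofReal_mul hk0.le]
    exact ENNReal.ofReal_le_ofReal (hpt v hv).1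
  · rw [← ENNReal.ofReal_le_ofReal_iff (by positivity), ENNReal.ofReal_mul hk0.le,
      ofReal_measureReal, hH, ← hLint, ← lintegral_const_mul' _ _ ENNReal.ofReal_ne_top]
    refine setLIntegral_mono' measurableSet_Ioo fun v hv => ?_
    rw [← ENNReal.ofReal_mul hk0.le]
    exact ENNReal.ofReal_le_ofReal (hpt v hv).2.1

/-! ### Weighted sums of Gamma-Gamma variables. -/

theorem gammaGammaMeasure_Iio_zero (α β : ℝ) : gammaGammaMeasure α β (Set.Iio 0) = 0 := by
  rw [gammaGammaMeasure, withDensity_apply _ measurableSet_Iio]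
  refine setLIntegral_eq_zero measurableSet_Iio fun x hx => ?_
  simp [gammaGammaPDF_of_nonpos α β (le_of_lt hx)]

theorem isEquivalent_real_map_sum_gammaGamma {Ω ι : Type*} [MeasurableSpace Ω] {P : Measure Ω}
    [IsProbabilityMeasure P] {α β a : ι → ℝ} (hα : ∀ m, 0 < α m) (hβ : ∀ m, 0 < β m)
    (ha : ∀ m, 0 < a m) (hne : ∀ m, α m ≠ β m) {Y : ι → Ω → ℝ}
    (hY : ∀ m, HasLaw (Y m) (gammaGammaMeasure (α m) (β m)) P) (hindep : iIndepFun Y P)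
    (S : Finset ι) :
    Asymptotics.IsEquivalent (𝓝[>] (0 : ℝ))
      (fun x => (P.map fun ω => ∑ m ∈ S, a m * Y m ω).real (Set.Iic x))
      (fun x => (∏ m ∈ S, ((a m) ^ (-min (α m) (β m)) *
        ((α m * β m) ^ min (α m) (β m) * Real.Gamma (max (α m) (β m) - min (α m) (β m)) /
          (Real.Gamma (α m) * Real.Gamma (β m))) * Real.Gamma (min (α m) (β m)))) /
        Real.Gamma (∑ m ∈ S, min (α m) (β m) + 1) * x ^ (∑ m ∈ S, min (α m) (β m))) := by
  classical
  have hYm : ∀ m, AEMeasurable (Y m) P := fun m => (hY m).aemeasurable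
  have hY0 : ∀ m, ∀ᵐ ω ∂P, 0 ≤ Y m ω := fun m => by
    refine (ae_map_iff (p := fun y : ℝ => 0 ≤ y) (hYm m) measurableSet_Ici).1 ?_
    rw [(hY m).map_eq, ae_iff]
    simpa [Set.Iio] using gammaGammaMeasure_Iio_zero (α m) (β m)
  induction S using Finset.induction_on with
  | empty =>
    -- The empty sum has the Dirac law at `0`: exponent `0`, constant `1`.
    refine Asymptotics.IsEquivalent.refl.congr_left ?_
    filter_upwards [self_mem_nhdsWithin] with x hx
    have hx0 : (0 : ℝ) ≤ x := le_of_lt hx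
    simp [Measure.map_const, measureReal_def, hx0]
  | insert i s hi ih =>
    have hq : ∀ m, 0 < min (α m) (β m) := fun m => lt_min (hα m) (hβ m)
    have hpq : ∀ m, 0 < max (α m) (β m) - min (α m) (β m) := fun m =>
      sub_pos.2 (min_lt_max.2 (hne m))
    have hD : ∀ m, 0 < (α m * β m) ^ min (α m) (β m) *
        Real.Gamma (max (α m) (β m) - min (α m) (β m)) /
          (Real.Gamma (α m) * Real.Gamma (β m)) := fun m =>
      div_pos (mul_pos (Real.rpow_pos_of_pos (mul_pos (hα m) (hβ m)) _)
        (Real.Gamma_pos_of_pos (hpq m)))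
        (mul_pos (Real.Gamma_pos_of_pos (hα m)) (Real.Gamma_pos_of_pos (hβ m)))
    have hXm : AEMeasurable (fun ω => ∑ m ∈ s, a m * Y m ω) P :=
      Finset.aemeasurable_fun_sum s fun m _ => (hYm m).const_mul (a m)
    have : IsProbabilityMeasure (P.map fun ω => ∑ m ∈ s, a m * Y m ω) :=
      Measure.isProbabilityMeasure_map hXm
    have hX0 : (P.map fun ω => ∑ m ∈ s, a m * Y m ω) (Set.Iio 0) = 0 := by
      have h : ∀ᵐ ω ∂P, 0 ≤ ∑ m ∈ s, a m * Y m ω := by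
        filter_upwards [(Finset.eventually_all s).2 fun m _ => hY0 m] with ω hω
        exact Finset.sum_nonneg fun m hm => mul_nonneg (ha m).le (hω m hm)
      rw [Measure.map_apply_of_aemeasurable hXm measurableSet_Iio]
      simpa [ae_iff, Set.preimage] using h
    have hlaw := (hY i).map_eq
    -- Finiteness comes from being the law of `Y i`, without integrating the density.
    have hfin : IsFiniteMeasure
        (volume.withDensity fun v => ENNReal.ofReal (gammaGammaPDF (α i) (β i) v)) := by
      have : IsProbabilityMeasure (P.map (Y i)) := Measure.isProbabilityMeasure_map (hYm i)
      rw [hlaw] at this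
      exact inferInstanceAs (IsFiniteMeasure (gammaGammaMeasure (α i) (β i)))
    have hstep := isEquivalent_prod_withDensity_add_mul_le _ hX0
      (measurable_gammaGammaPDF (α i) (β i)) (fun v => gammaGammaPDF_of_nonpos (α i) (β i)) (ha i)
      (Finset.sum_nonneg fun m (_ : m ∈ s) => (hq m).le) (hq i) (hD i)
      (Finset.prod_pos fun m (_ : m ∈ s) => mul_pos
        (mul_pos (Real.rpow_pos_of_pos (ha m) _) (hD m)) (Real.Gamma_pos_of_pos (hq m))) ih
      (gammaGammaPDF_isEquivalent (hα i) (hβ i) (hne i))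
    have hψ : Measurable fun y : ({i} : Finset ι) → ℝ => y ⟨i, Finset.mem_singleton_self i⟩ :=
      measurable_pi_apply (X := fun _ : ({i} : Finset ι) => ℝ) _
    have hXY : IndepFun (fun ω => ∑ m ∈ s, a m * Y m ω) (Y i) P := by
      have h := (hindep.indepFun_finset₀ s {i} (Finset.disjoint_singleton_right.2 hi) hYm).comp
        (φ := fun y : s → ℝ => ∑ m : s, a m * y m)
        (ψ := fun y : ({i} : Finset ι) → ℝ => y ⟨i, Finset.mem_singleton_self i⟩)
        (by fun_prop) hψ
      refine h.congr (ae_of_all _ fun ω => ?_) (ae_of_all _ fun ω => rfl)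
      exact Finset.sum_coe_sort s fun m => a m * Y m ω
    refine (hstep.congr_left ?_).congr_right ?_
    · refine Eventually.of_forall fun x => ?_
      beta_reduce
      have hset : MeasurableSet {p : ℝ × ℝ | p.1 + a i * p.2 ≤ x} :=
        measurableSet_le (by fun_prop) (by fun_prop)
      change ((P.map fun ω => ∑ m ∈ s, a m * Y m ω).prod
        (gammaGammaMeasure (α i) (β i))).real _ = _
      rw [← hlaw, ← hXY.map_prod_eq_prod_map_map hXm (hYm i),
        map_measureReal_apply_of_aemeasurable (hXm.prodMk (hYm i)) hset,
        map_measureReal_apply_of_aemeasurable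
          (Finset.aemeasurable_fun_sum _ fun m _ => (hYm m).const_mul (a m)) measurableSet_Iic]
      congr 1
      ext ω
      simp [Finset.sum_insert hi, add_comm]
    · refine Eventually.of_forall fun x => ?_
      simp only [Finset.sum_insert hi, Finset.prod_insert hi]
      rw [add_comm (min (α i) (β i))]
      ring

theorem lemma1 {Ω : Type*} [MeasurableSpace Ω] (P : Measure Ω) [IsProbabilityMeasure P]
    (N : ℕ) (α β ρ hbar : Fin N → ℝ)
    (hα : ∀ m, 0 < α m) (hβ : ∀ m, 0 < β m) (hρ : ∀ m, 0 < ρ m) (hhbar : ∀ m, 0 < hbar m)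
    (hαβ : ∀ (m : Fin N) (k : ℤ), α m - β m ≠ (k : ℝ))
    (htilde h : Fin N → Ω → ℝ)
    (hlaw : ∀ m, HasLaw (htilde m) (gammaGammaMeasure (α m) (β m)) P)
    (hindep : iIndepFun htilde P)
    (hh : ∀ m ω, h m ω = hbar m * htilde m ω)
    (p q : Fin N → ℝ)
    (hp : ∀ m, p m = max (α m) (β m)) (hq : ∀ m, q m = min (α m) (β m))
    (S : Finset (Fin N)) (hS : S.Nonempty) :
    Asymptotics.IsEquivalent (𝓝[>] (0 : ℝ))
      (fun x : ℝ => cdf (P.map (fun ω => ∑ m ∈ S, ρ m * h m ω)) x)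
      (fun x : ℝ =>
        (∏ m ∈ S, ((α m * β m / (hbar m * ρ m)) ^ q m *
            (Real.Gamma (q m) * Real.Gamma (p m - q m) /
              (Real.Gamma (α m) * Real.Gamma (β m))))) /
          ((∑ m ∈ S, q m) * Real.Gamma (∑ m ∈ S, q m)) *
        x ^ (∑ m ∈ S, q m)) := by
  have hne : ∀ m, α m ≠ β m := fun m h => hαβ m 0 (by simp [h])
  have key := isEquivalent_real_map_sum_gammaGamma (a := fun m => ρ m * hbar m) hα hβ
    (fun m => mul_pos (hρ m) (hhbar m)) hne hlaw hindep S
  have hsum : 0 < ∑ m ∈ S, q m := Finset.sum_pos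
    (fun m _ => by rw [hq]; exact lt_min (hα m) (hβ m)) hS
  have hfun : (fun ω => ∑ m ∈ S, ρ m * h m ω) = fun ω => ∑ m ∈ S, ρ m * hbar m * htilde m ω := by
    simp only [hh, mul_assoc]
  have hmeas : AEMeasurable (fun ω => ∑ m ∈ S, ρ m * hbar m * htilde m ω) P :=
    Finset.aemeasurable_fun_sum S fun m _ => (hlaw m).aemeasurable.const_mul _
  have : IsProbabilityMeasure (P.map fun ω => ∑ m ∈ S, ρ m * hbar m * htilde m ω) :=
    Measure.isProbabilityMeasure_map hmeas
  simp only [hfun, cdf_eq_real]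
  refine key.congr_right (Eventually.of_forall fun x => ?_)
  -- `Γ(Q + 1) = Q Γ(Q)` with `Q = ∑ q m`, nonzero because `S` is non-empty.
  simp only [← hq, ← hp, Real.Gamma_add_one hsum.ne']
  congr 2
  refine Finset.prod_congr rfl fun m _ => ?_
  have hr := mul_pos (hhbar m) (hρ m)
  rw [Real.div_rpow (mul_pos (hα m) (hβ m)).le hr.le, mul_comm (ρ m), Real.rpow_neg hr.le]
  ring
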